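/- Let $\mathbb Z_3$ be the ring of 3-adic integers with its usual topology, and for $m\ge 1$ let $U^{(m)}=\{u\in\mathbb Z_3: u\equiv 1 \pmod{3^m}\}$. For $q\in U^{(1)}$ let $\iota_q:\mathbb Z_3\to\mathbb Z_3$ be the continuous function with $\iota_q(n)=1+q+\cdots+q^{n-1}$ for every integer $n\ge 0$. A nontrivial 3-adic fixed point of $\iota_q$ is an element $z\in\mathbb Z_3\setminus\{0,1\}$ with $\iota_q(z)=z$. Theorem 6.1. There is a unique $q_0\in U^{(1)}-U^{(2)}$ with $q_0\equiv 7\pmod 9$ such that $\iota_{q_0}$ has no nontrivial 3-adic fixed point, and a unique $q_1\in U^{(1)}-U^{(2)}$ with $q_1\equiv 4\pmod 9$ such that $\iota_{q_1}$ has no nontrivial 3-adic fixed point. There is a homeomorphism (for the subspace topologies) $$\Psi: 3\mathbb Z_3\cup(1+3\mathbb Z_3)\longrightarrow U^{(1)}-U^{(2)}$$ such that $\Psi(0)=q_0$, $\Psi(1)=q_1$, and, for every $z\in 3\mathbb Z_3\cup(1+3\mathbb Z_3)$ with $z\ne 0,1$, $\Psi(z)$ is the unique $q\in U^{(1)}-U^{(2)}$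 with $\iota_q(z)=z$. Its inverse $\Phi=\Psi^{-1}$ sends each $q\in (U^{(1)}-U^{(2)})\setminus\{q_0,q_1\}$ to the unique nontrivial 3-adic fixed point of $\iota_q$ in $\mathbb Z_3$, and satisfies $\Phi(q_0)=0$, $\Phi(q_1)=1$. -/

import Mathlib

open Filter Topology

namespace QAnalog

variable {p : ℕ} [Fact p.Prime]

/-- The set `U^(m) = {u ∈ ℤ_p : u ≡ 1 mod p^m}`; for `m ≥ 1` these are the `m`-th principal
units. -/
def U (p : ℕ) [Fact p.Prime] (m : ℕ) : Set ℤ_[p] := {u | (p : ℤ_[p]) ^ m ∣ u - 1}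

/-- The `p`-adic interpolation `ι_q` of `n ↦ 1 + q + ⋯ + q^(n-1)`: the value at `z ∈ ℤ_p` is the
limit of `1 + q + ⋯ + q^(n-1)` as the natural number `n` tends to `z` in the `p`-adic topology. -/
noncomputable def iota (q z : ℤ_[p]) : ℤ_[p] :=
  limUnder (comap (Nat.cast : ℕ → ℤ_[p]) (𝓝 z)) (fun n => ∑ i ∈ Finset.range n, q ^ i)

/-- A nontrivial `p`-adic fixed point of `ι_q`, i.e. one different from `0` and `1`. -/
def IsNontrivialFixedPoint (q z : ℤ_[p]) : Prop := iota q z = z ∧ z ≠ 0 ∧ z ≠ 1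

/-- The set `3ℤ_3 ∪ (1 + 3ℤ_3)`. -/
def fixedPointDomain : Set ℤ_[3] := {z | 3 ∣ z} ∪ {z | 3 ∣ z - 1}

theorem zero_mem_fixedPointDomain : (0 : ℤ_[3]) ∈ fixedPointDomain := Or.inl (dvd_zero 3)

theorem one_mem_fixedPointDomain : (1 : ℤ_[3]) ∈ fixedPointDomain :=
  Or.inr (by simp)

/-- Any continuous function that agrees with `n ↦ 1 + q + ⋯ + q^(n-1)` on `ℕ` is `ι_q`. -/
theorem iota_eq_of_continuous (q : ℤ_[p]) (f : ℤ_[p] → ℤ_[p]) (hf : Continuous f)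
    (hn : ∀ n : ℕ, f n = ∑ i ∈ Finset.range n, q ^ i) : iota q = f := by
  funext z
  have hne : (comap (Nat.cast : ℕ → ℤ_[p]) (𝓝 z)).NeBot :=
    comap_neBot_iff_frequently.2 (by
      have := mem_closure_iff_frequently.1 (PadicInt.denseRange_natCast (p := p) z)
      exact this)
  refine Tendsto.limUnder_eq ?_
  have h : Tendsto (fun n : ℕ => f n) (comap (Nat.cast : ℕ → ℤ_[p]) (𝓝 z)) (𝓝 (f z)) :=
    (hf.tendsto z).comp tendsto_comap
  simpa only [hn] using h

/-- For `q ∈ U^(1)` the interpolation exists. -/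
theorem exists_interpolation (q : ℤ_[p]) (hq : q ∈ U p 1) :
    ∃ f : ℤ_[p] → ℤ_[p], Continuous f ∧ ∀ n : ℕ, f n = ∑ i ∈ Finset.range n, q ^ i := by
  have hlt : ‖q - 1‖ < 1 := (PadicInt.norm_lt_one_iff_dvd _).2 (by simpa [U] using hq)
  let a : ℕ → ℤ_[p] := fun n => if n = 0 then 0 else (q - 1) ^ (n - 1)
  have ha : Tendsto a atTop (𝓝 0) := by
    rw [← tendsto_add_atTop_iff_nat 1]
    simpa [a] using tendsto_pow_atTop_nhds_zero_of_norm_lt_one hlt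
  refine ⟨PadicInt.mahlerSeries a, map_continuous _, fun n => ?_⟩
  rw [PadicInt.mahlerSeries_apply_nat ha le_rfl, Finset.sum_range_succ']
  have key : ∀ n : ℕ, ∑ i ∈ Finset.range n, ((n.choose (i + 1) : ℕ) : ℤ_[p]) * (q - 1) ^ i
      = ∑ i ∈ Finset.range n, q ^ i := by
    intro n
    induction n with
    | zero => simp
    | succ n ih =>
      rw [Finset.sum_range_succ (fun i => q ^ i), ← ih]
      have h1 : q ^ n = ∑ i ∈ Finset.range (n + 1), ((n.choose i : ℕ) : ℤ_[p]) * (q - 1) ^ i := by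
        conv_lhs => rw [← sub_add_cancel q 1, add_pow]
        exact Finset.sum_congr rfl fun i _ => by simp [mul_comm]
      have h2 : ∑ i ∈ Finset.range n, ((n.choose (i + 1) : ℕ) : ℤ_[p]) * (q - 1) ^ i
          = ∑ i ∈ Finset.range (n + 1), ((n.choose (i + 1) : ℕ) : ℤ_[p]) * (q - 1) ^ i := by
        simp [Finset.sum_range_succ]
      rw [h1, h2, ← Finset.sum_add_distrib]
      exact Finset.sum_congr rfl fun i _ => by rw [Nat.choose_succ_succ]; push_cast; ring
  simpa [a] using key n

/-- For `q ∈ U^(1)` the map `ι_q` is continuous. -/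
theorem continuous_iota (q : ℤ_[p]) (hq : q ∈ U p 1) : Continuous (iota q) := by
  obtain ⟨f, hf, hn⟩ := exists_interpolation q hq
  rwa [iota_eq_of_continuous q f hf hn]

/-- For `q ∈ U^(1)` the map `ι_q` interpolates `n ↦ 1 + q + ⋯ + q^(n-1)`. -/
theorem iota_natCast (q : ℤ_[p]) (hq : q ∈ U p 1) (n : ℕ) :
    iota q (n : ℤ_[p]) = ∑ i ∈ Finset.range n, q ^ i := by
  obtain ⟨f, hf, hn⟩ := exists_interpolation q hq
  rw [iota_eq_of_continuous q f hf hn, hn]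

end QAnalog

/-!
Every `q ∈ U 3 1` is `1 + 3u`, and `q ∉ U 3 2` means that `u` is a unit. Expanding `q ^ i`
binomially gives `ι_q(z) = ∑_{k ≥ 1} C(z, k) (3u) ^ (k - 1)`, where the terms with `k ≥ 2` are all
divisible by `z (z - 1)`. With `w = z - 2` this reads (`two_mul_iota_sub`)

  `2 (ι_q(z) - z) = z (z - 1) · 3u · F(w, u)`,  `F(w, u) = ∑_k c_k C(w, k) u ^ k`,

where `c_k = 2 · 3 ^ k / ((k + 1) (k + 2))`. So, for `z ≠ 0, 1` and `u` a unit, `z` is a fixed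
point of `ι_q` exactly when `F(w, u) = 0`; this equation also makes sense at `z = 0` and `z = 1`,
and it is what defines `Ψ` there.

Now `c_0 = c_1 = 1`, while for `k ≥ 2` one has `c_k = 3 r_k` with `r_k` divisible by every
`1 ≤ j ≤ k`. Hence `F(w, u) = 1 + w u + 3 R(w, u)`, where `R` does not increase distances in either
variable: in `u` this is clear, and in `w` the divisibility of `r_k` compensates for the
denominators of the binomial coefficients (`sub_dvd_remainderCoeff_mul_choose_sub`). Two
consequences follow.

* For a unit `w`, the equation `F(w, u) = 0` is solved for `u` by the contraction principle, and for
  a unit `u` it is likewise solved for `w` (`exists_one_add_mul_add_three_mul_eq_zero`).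
* At a zero `w u ≡ -1` modulo `3`, so `w` and `u` are units, i.e. `z ∈ 3ℤ_3 ∪ (1 + 3ℤ_3)` and
  `q ∈ U 3 1 \ U 3 2`. Any two zeros satisfy `‖u - u'‖ = ‖w - w'‖`
  (`norm_sub_eq_of_fixedPointSeries_eq_zero`).

The zero set of `F` is therefore the graph of a bijection that scales distances by `1 / 3` when it
is expressed in `z` and `q`, hence of a homeomorphism. The congruence `w u ≡ -1` at `w = -2` and
`w = -1` gives `Ψ(0) ≡ 7` and `Ψ(1) ≡ 4` modulo `9`.
-/

open Filter Topology

namespace QAnalog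

/-! ### Coefficients of the reduced fixed point series -/

theorem natCast_dvd_pow_of_not_pow_succ_dvd {p : ℕ} [Fact p.Prime] {k N : ℕ}
    (h : ¬ p ^ (k + 1) ∣ N) : (N : ℤ_[p]) ∣ (p : ℤ_[p]) ^ k := by
  have hN : N ≠ 0 := by rintro rfl; exact h (dvd_zero _)
  obtain ⟨a, m, hm, rfl⟩ := Nat.exists_eq_pow_mul_and_not_dvd hN p (Fact.out : p.Prime).ne_one
  have hak : a ≤ k := by
    by_contra hlt
    exact h (dvd_mul_of_dvd_left (pow_dvd_pow p (by omega)) m)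
  have hu : IsUnit (m : ℤ_[p]) := by
    rw [← not_not (a := IsUnit _), PadicInt.not_isUnit_iff]
    simpa using (PadicInt.norm_int_lt_one_iff_dvd (p := p) (m : ℤ)).not.2 (by exact_mod_cast hm)
  rw [Nat.cast_mul, Nat.cast_pow, hu.mul_right_dvd]
  exact pow_dvd_pow _ hak

/-- The valuation bound behind the divisibility of `remainderCoeff k` by each positive `j ≤ k`.
For `k ≥ 5` the product is smaller than `3 ^ k`. -/
theorem not_three_pow_dvd_mul {j k : ℕ} (hk : 2 ≤ k) (hj : 1 ≤ j) (hjk : j ≤ k) :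
    ¬ 3 ^ k ∣ j * ((k + 1) * (k + 2)) := by
  rcases Nat.lt_or_ge k 5 with h5 | h5
  · interval_cases k <;> interval_cases j <;> decide
  · refine Nat.not_dvd_of_pos_of_lt (by positivity) ?_
    calc j * ((k + 1) * (k + 2)) ≤ k * ((k + 1) * (k + 2)) := Nat.mul_le_mul_right _ hjk
      _ < 3 ^ k := by
        clear hjk hk
        induction k, h5 using Nat.le_induction with
        | base => norm_num
        | succ n hn ih =>
          calc (n + 1) * ((n + 1 + 1) * (n + 1 + 2)) = (n + 1) * (n + 2) * (n + 3) := by ring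
            _ ≤ (n + 1) * (n + 2) * (n * 3) := Nat.mul_le_mul_left _ (by omega)
            _ = n * ((n + 1) * (n + 2)) * 3 := by ring
            _ < 3 ^ n * 3 := by omega
            _ = 3 ^ (n + 1) := (pow_succ 3 n).symm

/-- The coefficient `c_k = 2 · 3 ^ k / ((k + 1) (k + 2))` is a `3`-adic integer. It equals `1` for
`k ≤ 1` and lies in `3 j ℤ_3` for all `1 ≤ j ≤ k` when `k ≥ 2`. -/
theorem exists_remainderCoeff (k : ℕ) : ∃ r : ℤ_[3],
    ((if k ≤ 1 then 1 else 0) + 3 * r) * (((k + 1) * (k + 2) : ℕ) : ℤ_[3]) = 2 * 3 ^ k ∧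
      ∀ j : ℕ, 1 ≤ j → j ≤ k → (j : ℤ_[3]) ∣ r := by
  rcases Nat.lt_or_ge k 2 with hk | hk
  · refine ⟨0, ?_, fun _ _ _ => dvd_zero _⟩
    interval_cases k <;> norm_num
  · obtain ⟨n, rfl⟩ : ∃ n, k = n + 1 := ⟨k - 1, by omega⟩
    -- `r_k = 2 s`, where `s` is the quotient for `j = 1`; the other quotients show `j ∣ s`.
    have key : ∀ j : ℕ, 1 ≤ j → j ≤ n + 1 →
        (j : ℤ_[3]) * (((n + 1 + 1) * (n + 1 + 2) : ℕ) : ℤ_[3]) ∣ 3 ^ n := fun j h1 h2 => by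
      rw [← Nat.cast_mul]
      exact natCast_dvd_pow_of_not_pow_succ_dvd (not_three_pow_dvd_mul hk h1 h2)
    obtain ⟨s, hs⟩ := key 1 le_rfl (by omega)
    refine ⟨2 * s, ?_, fun j h1 h2 => ?_⟩
    · rw [if_neg (by omega), pow_succ, hs]
      push_cast
      ring
    · obtain ⟨t, ht⟩ := key j h1 h2
      have h0 : (((n + 1 + 1) * (n + 1 + 2) : ℕ) : ℤ_[3]) ≠ 0 := Nat.cast_ne_zero.2 (by positivity)
      have hst : s = j * t := mul_left_cancel₀ h0 (by
        rw [Nat.cast_one, one_mul] at hs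
        rw [← hs, ht]
        ring)
      exact ⟨2 * t, by rw [hst]; ring⟩

/-- The `3`-adic integer `r_k` with `2 · 3 ^ k / ((k + 1) (k + 2)) = e_k + 3 r_k`, where
`e_0 = e_1 = 1` and `e_k = 0` for `k ≥ 2`. In particular `r_0 = r_1 = 0`. -/
noncomputable def remainderCoeff (k : ℕ) : ℤ_[3] := (exists_remainderCoeff k).choose

theorem remainderCoeff_spec (k : ℕ) :
    ((if k ≤ 1 then 1 else 0) + 3 * remainderCoeff k) * (((k + 1) * (k + 2) : ℕ) : ℤ_[3])
      = 2 * 3 ^ k :=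
  (exists_remainderCoeff k).choose_spec.1

theorem natCast_dvd_remainderCoeff {j k : ℕ} (hj : 1 ≤ j) (hjk : j ≤ k) :
    (j : ℤ_[3]) ∣ remainderCoeff k :=
  (exists_remainderCoeff k).choose_spec.2 j hj hjk

theorem norm_le_norm_of_dvd {p : ℕ} [Fact p.Prime] {x y : ℤ_[p]} (h : x ∣ y) : ‖y‖ ≤ ‖x‖ := by
  obtain ⟨t, rfl⟩ := h
  rw [norm_mul]
  exact mul_le_of_le_one_right (norm_nonneg _) (PadicInt.norm_le_one t)

/-- The coefficients tend to zero because `3 ^ n ∣ r_k` as soon as `3 ^ n ≤ k`. -/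
theorem tendsto_remainderCoeff_mul_pow (u : ℤ_[3]) :
    Tendsto (fun k => remainderCoeff k * u ^ k) atTop (𝓝 0) := by
  rw [Metric.tendsto_atTop]
  intro ε hε
  obtain ⟨n, hn⟩ := PadicInt.exists_pow_neg_lt 3 hε
  refine ⟨3 ^ n, fun k hk => ?_⟩
  rw [dist_zero_right]
  refine lt_of_le_of_lt (norm_le_norm_of_dvd (dvd_mul_of_dvd_left
    (natCast_dvd_remainderCoeff (Nat.one_le_pow _ _ (by norm_num)) hk) _)) ?_
  rw [Nat.cast_pow, PadicInt.norm_p_pow]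
  exact hn

/-! ### The remainder and its Lipschitz estimates -/

/-- The function `R(w, u) = ∑_k r_k C(w, k) u ^ k` on `ℤ_3 × ℤ_3`, as a Mahler series in `w`. -/
noncomputable def remainder (w u : ℤ_[3]) : ℤ_[3] :=
  PadicInt.mahlerSeries (fun k => remainderCoeff k * u ^ k) w

theorem hasSum_remainder (w u : ℤ_[3]) :
    HasSum (fun k => Ring.choose w k * (remainderCoeff k * u ^ k)) (remainder w u) := by
  have h := (ContinuousMap.hasSum_apply
    (PadicInt.hasSum_mahlerSeries (tendsto_remainderCoeff_mul_pow u)) w)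
  rw [remainder]
  simpa only [PadicInt.mahlerTerm_apply, mahler_apply, smul_eq_mul] using h

theorem norm_sub_le_of_hasSum {p : ℕ} [Fact p.Prime] {f g : ℕ → ℤ_[p]} {a b d : ℤ_[p]}
    (hf : HasSum f a) (hg : HasSum g b) (h : ∀ k, d ∣ f k - g k) : ‖a - b‖ ≤ ‖d‖ := by
  have hs := hf.sub hg
  refine le_of_tendsto hs.norm (Eventually.of_forall fun s => ?_)
  exact norm_le_norm_of_dvd (Finset.dvd_sum fun k _ => h k)

theorem norm_remainder_sub_right_le (w u u' : ℤ_[3]) :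
    ‖remainder w u - remainder w u'‖ ≤ ‖u - u'‖ := by
  refine norm_sub_le_of_hasSum (hasSum_remainder w u) (hasSum_remainder w u') fun k => ?_
  rw [← mul_sub, ← mul_sub]
  exact ((sub_dvd_pow_sub_pow u u' k).mul_left _).mul_left _

/-- From `j C(h, j) = h C(h - 1, j - 1)`: a multiple of `j` clears the denominator that keeps `h`
from dividing `C(h, j)`. -/
theorem dvd_mul_choose {p : ℕ} [Fact p.Prime] {j : ℕ} (hj : 1 ≤ j) (h : ℤ_[p]) {r : ℤ_[p]}
    (hr : (j : ℤ_[p]) ∣ r) : h ∣ r * Ring.choose h j := by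
  obtain ⟨t, rfl⟩ := hr
  have := Ring.choose_smul_choose h hj
  rw [Nat.choose_one_right, Ring.choose_one_right, nsmul_eq_mul] at this
  exact ⟨t * Ring.choose (h - (1 : ℕ)) (j - 1), by linear_combination t * this⟩

/-- By Vandermonde, `C(w, k) - C(w', k) = ∑_{j ≥ 1} C(w - w', j) C(w', k - j)`, and `r_k` is
divisible by every `j` that occurs. -/
theorem sub_dvd_remainderCoeff_mul_choose_sub (w w' : ℤ_[3]) (k : ℕ) :
    w - w' ∣ remainderCoeff k * (Ring.choose w k - Ring.choose w' k) := by
  have h := Ring.add_choose_eq k (Commute.all (w - w') w')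
  rw [sub_add_cancel, Finset.Nat.sum_antidiagonal_eq_sum_range_succ_mk, Finset.sum_range_succ'] at h
  simp only [Ring.choose_zero_right, one_mul, Nat.sub_zero] at h
  rw [h, add_sub_cancel_right, Finset.mul_sum]
  refine Finset.dvd_sum fun i hi => ?_
  rw [← mul_assoc]
  exact (dvd_mul_choose (by omega) _ (natCast_dvd_remainderCoeff (by omega)
    (by have := Finset.mem_range.1 hi; omega))).mul_right _

theorem norm_remainder_sub_left_le (w w' u : ℤ_[3]) :
    ‖remainder w u - remainder w' u‖ ≤ ‖w - w'‖ := by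
  refine norm_sub_le_of_hasSum (hasSum_remainder w u) (hasSum_remainder w' u) fun k => ?_
  rw [show Ring.choose w k * (remainderCoeff k * u ^ k) - Ring.choose w' k *
    (remainderCoeff k * u ^ k) = remainderCoeff k * (Ring.choose w k - Ring.choose w' k) * u ^ k
    by ring]
  exact (sub_dvd_remainderCoeff_mul_choose_sub w w' k).mul_right _

/-! ### Factorization of `ι_q(z) - z` -/

/-- The function `F(w, u) = ∑_k c_k C(w, k) u ^ k` with `c_k = 2 · 3 ^ k / ((k + 1) (k + 2))`,
split into its terms with `k ≤ 1` and the rest, which is divisible by `3`. Up to a factor that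
vanishes only at `z = 0, 1` or `u = 0`, its value at `(z - 2, u)` is `ι_q(z) - z` for
`q = 1 + 3u`. -/
noncomputable def fixedPointSeries (w u : ℤ_[3]) : ℤ_[3] := 1 + w * u + 3 * remainder w u

theorem two_mul_choose_mul_three_pow (m k : ℕ) :
    2 * (((m + 2).choose (k + 2) : ℕ) : ℤ_[3]) * 3 ^ k = (m + 2) * (m + 1) *
      ((m.choose k : ℕ) * ((if k ≤ 1 then 1 else 0) + 3 * remainderCoeff k)) := by
  have h1 := Nat.add_one_mul_choose_eq (m + 1) (k + 1)
  have h2 := Nat.add_one_mul_choose_eq m k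
  have h3 := remainderCoeff_spec k
  apply_fun (Nat.cast : ℕ → ℤ_[3]) at h1 h2
  push_cast at h1 h2 h3
  simp only [add_assoc, one_add_one_eq_two] at h1 h2
  have e : (((m + 2).choose (k + 2) : ℕ) : ℤ_[3]) * ((k + 1) * (k + 2)) =
      (m + 2) * (m + 1) * (m.choose k : ℕ) := by
    linear_combination (-(k + 1) : ℤ_[3]) * h1 - (m + 2 : ℤ_[3]) * h2
  have h0 : ((k : ℤ_[3]) + 1) * (k + 2) ≠ 0 := by
    exact_mod_cast (by positivity : (k + 1) * (k + 2) ≠ 0)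
  refine mul_right_cancel₀ h0 ?_
  linear_combination 2 * 3 ^ k * e - (m + 2) * (m + 1) * ((m.choose k : ℕ) : ℤ_[3]) * h3

theorem fixedPointSeries_natCast (m : ℕ) (u : ℤ_[3]) :
    fixedPointSeries m u = ∑ k ∈ Finset.range (m + 1),
      (m.choose k : ℕ) * ((if k ≤ 1 then 1 else 0) + 3 * remainderCoeff k) * u ^ k := by
  have he : ∑ k ∈ Finset.range (m + 1),
      ((m.choose k : ℕ) : ℤ_[3]) * (if k ≤ 1 then 1 else 0) * u ^ k = 1 + m * u := by
    cases m with
    | zero => simp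
    | succ m =>
      rw [Finset.sum_range_succ', Finset.sum_range_succ']
      simp [add_comm]
  rw [fixedPointSeries, remainder,
    PadicInt.mahlerSeries_apply_nat (tendsto_remainderCoeff_mul_pow u) le_rfl, ← he, Finset.mul_sum,
    ← Finset.sum_add_distrib]
  refine Finset.sum_congr rfl fun k _ => ?_
  rw [nsmul_eq_mul]
  ring

theorem geom_sum_one_add {R : Type*} [CommRing R] (x : R) (n : ℕ) :
    ∑ i ∈ Finset.range n, (1 + x) ^ i = ∑ k ∈ Finset.range n, (n.choose (k + 1) : ℕ) * x ^ k := by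
  have h := congrArg (Polynomial.eval x) (Polynomial.geom_sum_X_comp_X_add_one_eq_sum (R := R) n)
  simpa [Polynomial.eval_finsetSum, Polynomial.eval_comp, Polynomial.eval_geom_sum, add_comm]
    using h

theorem one_add_three_mul_mem_U (u : ℤ_[3]) : 1 + 3 * u ∈ U 3 1 :=
  ⟨u, by push_cast; ring⟩

/-! ### Zeros of the fixed point series -/

/-- Both sides are continuous in `z`, so it suffices to compare them at natural numbers, where all
series are finite sums. -/
theorem two_mul_iota_sub (u z : ℤ_[3]) :
    2 * (iota (1 + 3 * u) z - z) = z * (z - 1) * (3 * u) * fixedPointSeries (z - 2) u := by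
  have hq := one_add_three_mul_mem_U u
  have hl : Continuous fun z => 2 * (iota (1 + 3 * u) z - z) := by
    have := continuous_iota _ hq
    fun_prop
  have hr : Continuous fun z => z * (z - 1) * (3 * u) * fixedPointSeries (z - 2) u := by
    unfold fixedPointSeries remainder
    fun_prop
  refine congrFun ((PadicInt.denseRange_natCast (p := 3)).equalizer hl hr (funext fun n => ?_)) z
  simp only [Function.comp_apply, iota_natCast _ hq]
  -- At `0` and `1` the factor `z (z - 1)` vanishes; elsewhere `z - 2` is a natural number.
  match n with
  | 0 => simp
  | 1 => simp
  | m + 2 =>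
    rw [geom_sum_one_add, Finset.sum_range_succ', Nat.cast_add, Nat.cast_two, add_sub_cancel_right,
      fixedPointSeries_natCast, Finset.mul_sum]
    simp only [zero_add, Nat.choose_one_right, pow_zero, mul_one, Nat.cast_add, Nat.cast_two,
      add_sub_cancel_right]
    rw [Finset.mul_sum]
    refine Finset.sum_congr rfl fun k _ => ?_
    rw [mul_pow, pow_succ, pow_succ]
    linear_combination 3 * u * u ^ k * two_mul_choose_mul_three_pow m k

theorem norm_three : ‖(3 : ℤ_[3])‖ = 3⁻¹ := by
  simpa using PadicInt.norm_p (p := 3)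

/-- A solution is a fixed point of the contraction `x ↦ -a⁻¹ (1 + 3 g x)`. -/
theorem exists_one_add_mul_add_three_mul_eq_zero {a : ℤ_[3]} (ha : IsUnit a) {g : ℤ_[3] → ℤ_[3]}
    (hg : ∀ x y, ‖g x - g y‖ ≤ ‖x - y‖) : ∃ x, 1 + a * x + 3 * g x = 0 := by
  obtain ⟨b, hb⟩ := ha.exists_right_inv
  have hc : ContractingWith 3⁻¹ fun x => -b * (1 + 3 * g x) := by
    refine ⟨by rw [inv_lt_one₀] <;> norm_num, LipschitzWith.of_dist_le_mul fun x y => ?_⟩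
    rw [dist_eq_norm, dist_eq_norm, show -b * (1 + 3 * g x) - -b * (1 + 3 * g y)
      = -b * (3 * (g x - g y)) by ring, norm_mul, norm_mul, norm_three]
    calc ‖-b‖ * (3⁻¹ * ‖g x - g y‖) ≤ 1 * (3⁻¹ * ‖x - y‖) := by
          gcongr
          · exact PadicInt.norm_le_one _
          · exact hg x y
      _ = _ := by simp
  refine ⟨ContractingWith.fixedPoint _ hc, ?_⟩
  have h : -b * (1 + 3 * g _) = _ := hc.fixedPoint_isFixedPt
  linear_combination -a * h - (1 + 3 * g (ContractingWith.fixedPoint _ hc)) * hb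

theorem exists_fixedPointSeries_right_eq_zero {w : ℤ_[3]} (hw : IsUnit w) :
    ∃ u, fixedPointSeries w u = 0 :=
  exists_one_add_mul_add_three_mul_eq_zero hw (norm_remainder_sub_right_le w)

theorem exists_fixedPointSeries_left_eq_zero {u : ℤ_[3]} (hu : IsUnit u) :
    ∃ w, fixedPointSeries w u = 0 := by
  simpa only [fixedPointSeries, mul_comm u] using exists_one_add_mul_add_three_mul_eq_zero hu
    fun w w' => norm_remainder_sub_left_le w w' u

theorem three_dvd_of_fixedPointSeries_eq_zero {w u : ℤ_[3]} (h : fixedPointSeries w u = 0) :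
    3 ∣ w * u + 1 :=
  ⟨-remainder w u, by rw [fixedPointSeries] at h; linear_combination h⟩

theorem isUnit_of_three_dvd_add_one {x : ℤ_[3]} (h : 3 ∣ x + 1) : IsUnit x := by
  rw [← not_not (a := IsUnit x), PadicInt.not_isUnit_iff, PadicInt.norm_lt_one_iff_dvd]
  intro hx
  have h1 : ((3 : ℕ) : ℤ_[3]) ∣ 1 := by simpa using dvd_sub h hx
  exact PadicInt.prime_p.not_isUnit (isUnit_of_dvd_one h1)

/-! ### The domain and the range in terms of units -/

/-- Subtracting the two equations gives `w (u - u') + (w - w') u' = -3 (R(w, u) - R(w', u'))` with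
units `w` and `u'`. If `‖u - u'‖ ≠ ‖w - w'‖`, the left side has norm the larger of the two, and
the right side at most a third of it. -/
theorem norm_sub_eq_of_fixedPointSeries_eq_zero {w u w' u' : ℤ_[3]}
    (h : fixedPointSeries w u = 0) (h' : fixedPointSeries w' u' = 0) :
    ‖u - u'‖ = ‖w - w'‖ := by
  have hw : ‖w‖ = 1 := PadicInt.isUnit_iff.1 <| isUnit_of_mul_isUnit_left <|
    isUnit_of_three_dvd_add_one (three_dvd_of_fixedPointSeries_eq_zero h)
  have hu' : ‖u'‖ = 1 := PadicInt.isUnit_iff.1 <| isUnit_of_mul_isUnit_right <|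
    isUnit_of_three_dvd_add_one (three_dvd_of_fixedPointSeries_eq_zero h')
  have hR : ‖remainder w u - remainder w' u'‖ ≤ max ‖u - u'‖ ‖w - w'‖ := by
    rw [← sub_add_sub_cancel (remainder w u) (remainder w u')]
    exact (PadicInt.nonarchimedean _ _).trans (max_le_max (norm_remainder_sub_right_le _ _ _)
      (norm_remainder_sub_left_le _ _ _))
  have hn : ‖w * (u - u') + (w - w') * u'‖ = 3⁻¹ * ‖remainder w u - remainder w' u'‖ := by
    rw [show w * (u - u') + (w - w') * u' = -(3 * (remainder w u - remainder w' u')) by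
      rw [fixedPointSeries] at h h'; linear_combination h - h', norm_neg, norm_mul, norm_three]
  by_contra hne
  have hmax := PadicInt.norm_add_eq_max_of_ne (q := w * (u - u')) (r := (w - w') * u')
    (by simpa [hw, hu'] using hne)
  rw [hn, norm_mul, norm_mul, hw, hu', one_mul, mul_one] at hmax
  have hpos : 0 < max ‖u - u'‖ ‖w - w'‖ := by
    rcases lt_or_gt_of_ne hne with h | h
    · exact lt_max_of_lt_right ((norm_nonneg _).trans_lt h)
    · exact lt_max_of_lt_left ((norm_nonneg _).trans_lt h)
  linarith

theorem three_dvd_cases (x : ℤ_[3]) : 3 ∣ x ∨ 3 ∣ x - 1 ∨ 3 ∣ x - 2 := by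
  obtain ⟨n, hn, hx⟩ := PadicInt.exists_mem_range (p := 3) x
  rw [PadicInt.maximalIdeal_eq_span_p, Ideal.mem_span_singleton] at hx
  interval_cases n
  · left; simpa using hx
  · right; left; simpa using hx
  · right; right; simpa using hx

theorem isUnit_iff_three_dvd {x : ℤ_[3]} : IsUnit x ↔ 3 ∣ x - 1 ∨ 3 ∣ x - 2 := by
  have h0 : IsUnit x ↔ ¬ 3 ∣ x := by
    rw [← not_iff_not, not_not, PadicInt.not_isUnit_iff, PadicInt.norm_lt_one_iff_dvd]
    rfl
  constructor
  · intro h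
    exact (three_dvd_cases x).resolve_left (h0.1 h)
  · rintro (h | h)
    · rw [← IsUnit.neg_iff]
      exact isUnit_of_three_dvd_add_one (by rw [← dvd_neg]; convert h using 1; ring)
    · exact isUnit_of_three_dvd_add_one (by convert dvd_add h (dvd_refl 3) using 1; ring)

theorem mem_fixedPointDomain_iff {z : ℤ_[3]} : z ∈ fixedPointDomain ↔ IsUnit (z - 2) := by
  have h1 : 3 ∣ z ↔ 3 ∣ z - 2 - 1 := by
    rw [show z - 2 - 1 = z - 3 by ring]; exact (dvd_sub_self_right).symm
  have h2 : 3 ∣ z - 1 ↔ 3 ∣ z - 2 - 2 := by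
    rw [show z - 2 - 2 = z - 1 - 3 by ring]; exact (dvd_sub_self_right).symm
  rw [isUnit_iff_three_dvd, ← h1, ← h2]
  rfl

theorem one_add_three_mul_mem_iff {u : ℤ_[3]} : 1 + 3 * u ∈ U 3 1 \ U 3 2 ↔ IsUnit u := by
  have h3 : (3 : ℤ_[3]) ≠ 0 := by norm_num
  have : 1 + 3 * u ∈ U 3 2 ↔ (3 : ℤ_[3]) ∣ u := by
    rw [U, Set.mem_ofPred_eq, add_sub_cancel_left, pow_two, Nat.cast_ofNat, mul_dvd_mul_iff_left h3]
  rw [Set.mem_sdiff, this, ← not_iff_not (b := IsUnit u), PadicInt.not_isUnit_iff,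
    PadicInt.norm_lt_one_iff_dvd]
  simp [one_add_three_mul_mem_U]

theorem exists_eq_one_add_three_mul {q : ℤ_[3]} (hq : q ∈ U 3 1) : ∃ u, q = 1 + 3 * u := by
  obtain ⟨u, hu⟩ := hq
  exact ⟨u, by push_cast at hu; linear_combination hu⟩

/-! ### The correspondence between fixed points and parameters -/

/-- The relation whose graph is that of `Ψ`: `q = 1 + 3u` with `F(z - 2, u) = 0`. For `z ≠ 0, 1` and
`q ∈ U 3 1 \ U 3 2` it says that `z` is a fixed point of `ι_q`, and it extends this relation to
`z = 0` and `z = 1`, which are fixed points of every `ι_q`. -/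
def Corresponds (z q : ℤ_[3]) : Prop := ∃ u, q = 1 + 3 * u ∧ fixedPointSeries (z - 2) u = 0

theorem corresponds_one_add_three_mul {z u : ℤ_[3]} :
    Corresponds z (1 + 3 * u) ↔ fixedPointSeries (z - 2) u = 0 := by
  constructor
  · rintro ⟨v, hv, h⟩
    rwa [mul_left_cancel₀ (by norm_num : (3 : ℤ_[3]) ≠ 0) (add_left_cancel hv)]
  · exact fun h => ⟨u, rfl, h⟩

theorem iota_eq_self_iff_corresponds {z q : ℤ_[3]} (hq : q ∈ U 3 1 \ U 3 2) (h0 : z ≠ 0)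
    (h1 : z ≠ 1) : iota q z = z ↔ Corresponds z q := by
  obtain ⟨u, rfl⟩ := exists_eq_one_add_three_mul hq.1
  have hu : u ≠ 0 := (one_add_three_mul_mem_iff.1 hq).ne_zero
  rw [corresponds_one_add_three_mul, ← sub_eq_zero,
    ← mul_eq_zero_iff_left (two_ne_zero : (2 : ℤ_[3]) ≠ 0), two_mul_iota_sub,
    mul_eq_zero_iff_left]
  exact mul_ne_zero (mul_ne_zero h0 (sub_ne_zero.2 h1)) (mul_ne_zero (by norm_num) hu)

theorem Corresponds.mem_fixedPointDomain {z q : ℤ_[3]} (h : Corresponds z q) :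
    z ∈ fixedPointDomain := by
  obtain ⟨u, -, h⟩ := h
  exact mem_fixedPointDomain_iff.2 <| isUnit_of_mul_isUnit_left <|
    isUnit_of_three_dvd_add_one (three_dvd_of_fixedPointSeries_eq_zero h)

theorem Corresponds.mem_diff {z q : ℤ_[3]} (h : Corresponds z q) : q ∈ U 3 1 \ U 3 2 := by
  obtain ⟨u, rfl, h⟩ := h
  exact one_add_three_mul_mem_iff.2 <| isUnit_of_mul_isUnit_right <|
    isUnit_of_three_dvd_add_one (three_dvd_of_fixedPointSeries_eq_zero h)

theorem exists_corresponds_right {z : ℤ_[3]} (hz : z ∈ fixedPointDomain) :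
    ∃ q, Corresponds z q := by
  obtain ⟨u, hu⟩ := exists_fixedPointSeries_right_eq_zero (mem_fixedPointDomain_iff.1 hz)
  exact ⟨1 + 3 * u, u, rfl, hu⟩

theorem exists_corresponds_left {q : ℤ_[3]} (hq : q ∈ U 3 1 \ U 3 2) : ∃ z, Corresponds z q := by
  obtain ⟨u, rfl⟩ := exists_eq_one_add_three_mul hq.1
  obtain ⟨w, hw⟩ := exists_fixedPointSeries_left_eq_zero (one_add_three_mul_mem_iff.1 hq)
  exact ⟨w + 2, u, rfl, by rwa [add_sub_cancel_right]⟩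

theorem Corresponds.dist_eq {z q z' q' : ℤ_[3]} (h : Corresponds z q) (h' : Corresponds z' q') :
    dist q q' = 3⁻¹ * dist z z' := by
  obtain ⟨u, rfl, h⟩ := h
  obtain ⟨u', rfl, h'⟩ := h'
  have := norm_sub_eq_of_fixedPointSeries_eq_zero h h'
  rw [sub_sub_sub_cancel_right] at this
  rw [dist_eq_norm, dist_eq_norm, ← this, add_sub_add_left_eq_sub, ← mul_sub, norm_mul,
    norm_three]

theorem Corresponds.eq_iff {z q z' q' : ℤ_[3]} (h : Corresponds z q) (h' : Corresponds z' q') :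
    q = q' ↔ z = z' := by
  rw [← dist_eq_zero, h.dist_eq h', mul_eq_zero_iff_left (by norm_num), dist_eq_zero]

/-! ### The homeomorphism and its values at `0` and `1` -/

/-- The homeomorphism `Ψ` whose graph is `Corresponds`. -/
noncomputable def fixedPointHomeomorph : fixedPointDomain ≃ₜ ↥(U 3 1 \ U 3 2) where
  toFun z := ⟨_, (exists_corresponds_right z.2).choose_spec.mem_diff⟩
  invFun q := ⟨_, (exists_corresponds_left q.2).choose_spec.mem_fixedPointDomain⟩
  left_inv z := Subtype.ext <| ((exists_corresponds_left
    (exists_corresponds_right z.2).choose_spec.mem_diff).choose_spec.eq_iff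
    (exists_corresponds_right z.2).choose_spec).1 rfl
  right_inv q := Subtype.ext <| ((exists_corresponds_right
    (exists_corresponds_left q.2).choose_spec.mem_fixedPointDomain).choose_spec.eq_iff
    (exists_corresponds_left q.2).choose_spec).2 rfl
  continuous_toFun := LipschitzWith.continuous (K := 3⁻¹) <| LipschitzWith.of_dist_le_mul
    fun z z' => by
      rw [Subtype.dist_eq, (exists_corresponds_right z.2).choose_spec.dist_eq
        (exists_corresponds_right z'.2).choose_spec]
      simp [Subtype.dist_eq]
  continuous_invFun := LipschitzWith.continuous (K := 3) <| LipschitzWith.of_dist_le_mul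
    fun q q' => by
      rw [Subtype.dist_eq q q', (exists_corresponds_left q.2).choose_spec.dist_eq
        (exists_corresponds_left q'.2).choose_spec]
      simp [Subtype.dist_eq]

theorem corresponds_fixedPointHomeomorph (z : fixedPointDomain) :
    Corresponds z (fixedPointHomeomorph z) :=
  (exists_corresponds_right z.2).choose_spec

theorem corresponds_iff_eq_fixedPointHomeomorph {z : fixedPointDomain} {q : ↥(U 3 1 \ U 3 2)} :
    Corresponds z q ↔ q = fixedPointHomeomorph z :=
  ⟨fun h => Subtype.ext ((h.eq_iff (corresponds_fixedPointHomeomorph z)).2 rfl),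
    fun h => h ▸ corresponds_fixedPointHomeomorph z⟩

theorem corresponds_iff_eq_fixedPointHomeomorph_symm {z : ℤ_[3]} {q : ↥(U 3 1 \ U 3 2)} :
    Corresponds z q ↔ z = fixedPointHomeomorph.symm q := by
  have h : Corresponds (fixedPointHomeomorph.symm q) q :=
    corresponds_iff_eq_fixedPointHomeomorph.2 (fixedPointHomeomorph.apply_symm_apply q).symm
  exact ⟨fun h' => (h'.eq_iff h).1 rfl, fun e => e ▸ h⟩

theorem isNontrivialFixedPoint_iff {q : ↥(U 3 1 \ U 3 2)} {z : ℤ_[3]} :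
    IsNontrivialFixedPoint (q : ℤ_[3]) z ↔ z = fixedPointHomeomorph.symm q ∧ z ≠ 0 ∧ z ≠ 1 :=
  and_congr_left fun h => by
    rw [iota_eq_self_iff_corresponds q.2 h.1 h.2, corresponds_iff_eq_fixedPointHomeomorph_symm]

theorem not_exists_isNontrivialFixedPoint_iff {q : ↥(U 3 1 \ U 3 2)} :
    (¬ ∃ z, IsNontrivialFixedPoint (q : ℤ_[3]) z) ↔
      q = fixedPointHomeomorph ⟨0, zero_mem_fixedPointDomain⟩ ∨
        q = fixedPointHomeomorph ⟨1, one_mem_fixedPointDomain⟩ := by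
  simp only [isNontrivialFixedPoint_iff, exists_eq_left, ← fixedPointHomeomorph.symm_apply_eq,
    Subtype.ext_iff]
  tauto

theorem nine_dvd_fixedPointHomeomorph_zero_sub :
    (9 : ℤ_[3]) ∣ fixedPointHomeomorph ⟨0, zero_mem_fixedPointDomain⟩ - 7 := by
  obtain ⟨u, hq, h⟩ := corresponds_fixedPointHomeomorph ⟨0, zero_mem_fixedPointDomain⟩
  obtain ⟨t, ht⟩ := three_dvd_of_fixedPointSeries_eq_zero h
  rw [hq]
  exact ⟨t + u - 1, by linear_combination 3 * ht⟩

theorem nine_dvd_fixedPointHomeomorph_one_sub :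
    (9 : ℤ_[3]) ∣ fixedPointHomeomorph ⟨1, one_mem_fixedPointDomain⟩ - 4 := by
  obtain ⟨u, hq, h⟩ := corresponds_fixedPointHomeomorph ⟨1, one_mem_fixedPointDomain⟩
  obtain ⟨t, ht⟩ := three_dvd_of_fixedPointSeries_eq_zero h
  rw [hq]
  exact ⟨-t, by linear_combination -3 * ht⟩

theorem not_nine_dvd_sub_seven_and_sub_four {q : ℤ_[3]} (h7 : 9 ∣ q - 7) : ¬ 9 ∣ q - 4 := by
  intro h4
  have h := dvd_sub h4 h7
  rw [sub_sub_sub_cancel_left] at h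
  have := (PadicInt.pow_p_dvd_int_iff (p := 3) 2 3).1 (by norm_num at h ⊢; exact h)
  norm_num at this

end QAnalog

open QAnalog

theorem theorem6p1 :
    ∃ q₀ q₁ : ↥(QAnalog.U 3 1 \ QAnalog.U 3 2),
      -- `q₀` is the unique element congruent to 7 mod 9 without nontrivial fixed point
      (∀ q : ↥(QAnalog.U 3 1 \ QAnalog.U 3 2),
        ((9 : ℤ_[3]) ∣ (q : ℤ_[3]) - 7 ∧ ¬ ∃ z, QAnalog.IsNontrivialFixedPoint (q : ℤ_[3]) z)
          ↔ q = q₀) ∧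
      -- `q₁` is the unique element congruent to 4 mod 9 without nontrivial fixed point
      (∀ q : ↥(QAnalog.U 3 1 \ QAnalog.U 3 2),
        ((9 : ℤ_[3]) ∣ (q : ℤ_[3]) - 4 ∧ ¬ ∃ z, QAnalog.IsNontrivialFixedPoint (q : ℤ_[3]) z)
          ↔ q = q₁) ∧
      ∃ Ψ : ↥QAnalog.fixedPointDomain ≃ₜ ↥(QAnalog.U 3 1 \ QAnalog.U 3 2),
        Ψ ⟨0, QAnalog.zero_mem_fixedPointDomain⟩ = q₀ ∧
        Ψ ⟨1, QAnalog.one_mem_fixedPointDomain⟩ = q₁ ∧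
        -- for `z ≠ 0, 1`, `Ψ z` is the unique `q` with `ι_q(z) = z`
        (∀ z : ↥QAnalog.fixedPointDomain, (z : ℤ_[3]) ≠ 0 → (z : ℤ_[3]) ≠ 1 →
          ∀ q : ↥(QAnalog.U 3 1 \ QAnalog.U 3 2),
            QAnalog.iota (q : ℤ_[3]) (z : ℤ_[3]) = (z : ℤ_[3]) ↔ q = Ψ z) ∧
        -- for `q ≠ q₀, q₁`, `Ψ⁻¹ q` is the unique nontrivial fixed point of `ι_q` in `ℤ_3`
        (∀ q : ↥(QAnalog.U 3 1 \ QAnalog.U 3 2), q ≠ q₀ → q ≠ q₁ →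
          ∀ z : ℤ_[3],
            QAnalog.IsNontrivialFixedPoint (q : ℤ_[3]) z ↔ z = (Ψ.symm q : ℤ_[3])) ∧
        ((Ψ.symm q₀ : ↥QAnalog.fixedPointDomain) : ℤ_[3]) = 0 ∧
        ((Ψ.symm q₁ : ↥QAnalog.fixedPointDomain) : ℤ_[3]) = 1 := by
  have h0 := nine_dvd_fixedPointHomeomorph_zero_sub
  have h1 := nine_dvd_fixedPointHomeomorph_one_sub
  refine ⟨fixedPointHomeomorph ⟨0, zero_mem_fixedPointDomain⟩,
    fixedPointHomeomorph ⟨1, one_mem_fixedPointDomain⟩, fun q => ?_, fun q => ?_,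
    fixedPointHomeomorph, rfl, rfl, fun z hz0 hz1 q => ?_, fun q hq0 hq1 z => ?_,
    by rw [Homeomorph.symm_apply_apply], by rw [Homeomorph.symm_apply_apply]⟩
  · rw [not_exists_isNontrivialFixedPoint_iff]
    constructor
    · rintro ⟨h, rfl | rfl⟩
      · rfl
      · exact absurd h1 (not_nine_dvd_sub_seven_and_sub_four h)
    · rintro rfl
      exact ⟨h0, Or.inl rfl⟩
  · rw [not_exists_isNontrivialFixedPoint_iff]
    constructor
    · rintro ⟨h, rfl | rfl⟩
      · exact absurd h (not_nine_dvd_sub_seven_and_sub_four h0)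
      · rfl
    · rintro rfl
      exact ⟨h1, Or.inr rfl⟩
  · rw [iota_eq_self_iff_corresponds q.2 hz0 hz1, corresponds_iff_eq_fixedPointHomeomorph]
  · rw [isNontrivialFixedPoint_iff, and_iff_left_iff_imp]
    rintro rfl
    rw [Ne, ← fixedPointHomeomorph.symm_apply_eq, Subtype.ext_iff] at hq0 hq1
    exact ⟨hq0, hq1⟩
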